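/- Let $E=(E^0,E^1,s,r)$ be an arbitrary directed graph and $K$ a field. A path is a finite sequence $p=e_1\cdots e_n$ of edges with $r(e_i)=s(e_{i+1})$, with length $|p|=n$, source $s(p)=s(e_1)$ and range $r(p)=r(e_n)$; vertices are the paths of length $0$. A vertex $v$ is regular if $s^{-1}(v)$ is nonempty and finite. The Leavitt path algebra $L_K(E)$ is the (not necessarily unital) associative $K$-algebra generated by $E^0\cup E^1\cup\{e^*: e\in E^1\}$ subject to $vw=\delta_{v,w}v$, $s(e)e=e\,r(e)=e$, $r(e)e^*=e^*s(e)=e^*$, $e^*f=\delta_{e,f}r(e)$ for all $v,w\in E^0$, $e,f\in E^1$, and (CK2) $v=\sum_{e\in s^{-1}(v)}ee^*$ for every regular vertex $v$. Put $v^*=v$ and $(e_1\cdots e_n)^*=e_n^*\cdots e_1^*$, and let $G_E\subseteq L_K(E)$ be the set of all $pq^*$ with $p,q$ paths such that $r(p)=r(q)$. Rings and algebras are associative, not necessarily unital. A trace is an additive map $t$ between rings with $t(xy)=t(yx)$ for all $x,y$. (a) Let $T$ be a $K$-algebra and let $t:G_E\to T$ be a map with $t(pq^*)=\delta_{p,q}\,t(r(p))$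 for all paths $p,q$ with $r(p)=r(q)$. If the values of $t$ on the vertices agree with (CK2), that is, $t(v)=\sum_{e\in s^{-1}(v)}t(r(e))$ for every regular vertex $v$, then $t$ extends uniquely to a $K$-linear $T$-valued trace on $L_K(E)$. Conversely, if $t$ extends to a $K$-linear $T$-valued trace on $L_K(E)$, then its values on the vertices agree with (CK2). (b) Let $t$ be a trace on $L_K(E)$ with values in any ring. The following are equivalent: (1) $t(pq^*)=\delta_{p,q}\,t(r(p))$ for all paths $p,q$; (2) $t(pq^*)=0$ for all paths $p,q$ with $|p|\neq|q|$. (c) Let $t$ be a trace on $L_K(E)$ with values in a $K$-algebra. Each of (1) and (2) implies gauge invariance: (3) $t(pq^*)=k^{|p|-|q|}\,t(pq^*)$ for all paths $p,q$ and all nonzero $k\in K$. If $K$ has characteristic zero, then each of (1) and (2) is equivalent to (3). -/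

import Mathlib

universe u w

/-- A directed graph `(E⁰, E¹, s, r)` with vertex set `V` and edge set `D`: any two maps
`s` (source) and `r` (range) from edges to vertices.  Loops, parallel edges, infinitely many
vertices and infinitely many edges are allowed. -/
structure DirectedGraph (V : Type u) (D : Type w) where
  s : D → V
  r : D → V

namespace DirectedGraph

section Graph

variable {V : Type u} {D : Type w} (E : DirectedGraph V D)

/-- `l = e₁ … eₙ` is a list of composable edges starting at `v`, that is `s(e₁) = v` and
`r(eᵢ) = s(eᵢ₊₁)`. -/
def IsWalk : V → List D → Prop
  | _, [] => True
  | v, e :: l => E.s e = v ∧ IsWalk (E.r e) l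

/-- The end point of the list of edges `l` when one starts at `v`. -/
def walkEnd : V → List D → V
  | v, [] => v
  | _, e :: l => walkEnd (E.r e) l

/-- A path: a finite list of composable edges together with its source.  The paths without
edges are the vertices; a path with at least one edge is determined by its edges. -/
@[ext]
structure Path where
  source : V
  edges : List D
  isWalk : E.IsWalk source edges

/-- The range `r(p)` of a path. -/
def Path.range {E : DirectedGraph V D} (p : E.Path) : V := E.walkEnd p.source p.edges

/-- The length `|p|` of a path. -/
def Path.length {E : DirectedGraph V D} (p : E.Path) : ℕ := p.edges.length

/-- A vertex as a path of length zero. -/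
def Path.nil (v : V) : E.Path := ⟨v, [], trivial⟩

/-- A vertex is regular if it emits at least one and only finitely many edges. -/
def IsRegular (v : V) : Prop := {e : D | E.s e = v}.Nonempty ∧ {e : D | E.s e = v}.Finite

/-- The finite set `s⁻¹(v)` of the edges emitted by a regular vertex. -/
noncomputable def IsRegular.out {E : DirectedGraph V D} {v : V} (h : E.IsRegular v) : Finset D :=
  h.2.toFinset

/-- Graph traces: maps `d` on vertices with `d(v) = ∑_{s(e) = v} d(r(e))` for `v` regular. -/
def IsGraphTrace {T : Type*} [AddCommMonoid T] (d : V → T) : Prop :=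
  ∀ (v : V) (h : E.IsRegular v), d v = ∑ e ∈ h.out, d (E.r e)

end Graph

/-- The generators `E⁰ ∪ E¹ ∪ {e* | e ∈ E¹}`. -/
inductive Gen (V : Type u) (D : Type w) : Type (max u w)
  | vertex (v : V)
  | edge (e : D)
  | ghost (e : D)

section Algebra

variable {V : Type u} {D : Type w} (E : DirectedGraph V D) (K : Type*) [Field K]

/-- The free associative (non-unital) `K`-algebra on the generators: its basis consists of the
nonempty words in the generators. -/
abbrev FreeAlg (_E : DirectedGraph V D) (K : Type*) [Field K] : Type _ :=
  MonoidAlgebra K (FreeSemigroup (Gen V D))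

/-- A generator as an element of the free algebra. -/
noncomputable def gen (x : Gen V D) : E.FreeAlg K :=
  MonoidAlgebra.single (FreeSemigroup.of x) 1

open Classical in
/-- The defining relations (V), (E1), (E2), (CK1), (CK2). -/
inductive LeavittRel : E.FreeAlg K → E.FreeAlg K → Prop
  | vertex_mul_vertex (v w : V) :
      LeavittRel (E.gen K (.vertex v) * E.gen K (.vertex w))
        (if v = w then E.gen K (.vertex v) else 0)
  | source_mul_edge (e : D) :
      LeavittRel (E.gen K (.vertex (E.s e)) * E.gen K (.edge e)) (E.gen K (.edge e))
  | edge_mul_range (e : D) :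
      LeavittRel (E.gen K (.edge e) * E.gen K (.vertex (E.r e))) (E.gen K (.edge e))
  | range_mul_ghost (e : D) :
      LeavittRel (E.gen K (.vertex (E.r e)) * E.gen K (.ghost e)) (E.gen K (.ghost e))
  | ghost_mul_source (e : D) :
      LeavittRel (E.gen K (.ghost e) * E.gen K (.vertex (E.s e))) (E.gen K (.ghost e))
  | ck1 (e f : D) :
      LeavittRel (E.gen K (.ghost e) * E.gen K (.edge f))
        (if e = f then E.gen K (.vertex (E.r e)) else 0)
  | ck2 (v : V) (h : E.IsRegular v) :
      LeavittRel (E.gen K (.vertex v)) (∑ e ∈ h.out, E.gen K (.edge e) * E.gen K (.ghost e))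

/-- The smallest `K`-linear ring congruence containing the defining relations.  (As the rings are
non-unital, compatibility with scalars has to be asked for: it is obtained by closing the set of
relations under scalar multiplication.) -/
noncomputable def leavittCon : RingCon (E.FreeAlg K) :=
  ringConGen fun a b => ∃ (c : K) (x y : E.FreeAlg K), E.LeavittRel K x y ∧ a = c • x ∧ b = c • y

theorem leavittCon_smul (c : K) {x y : E.FreeAlg K} (h : E.leavittCon K x y) :
    E.leavittCon K (c • x) (c • y) := by
  change RingConGen.Rel _ x y at h
  change RingConGen.Rel _ (c • x) (c • y)
  induction h with
  | of x y h =>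
    obtain ⟨d, a, b, hab, rfl, rfl⟩ := h
    exact .of _ _ ⟨c * d, a, b, hab, (mul_smul c d a).symm, (mul_smul c d b).symm⟩
  | refl x => exact .refl _
  | symm _ ih => exact .symm ih
  | trans _ _ ih₁ ih₂ => exact .trans ih₁ ih₂
  | add _ _ ih₁ ih₂ =>
    rw [smul_add, smul_add]
    exact .add ih₁ ih₂
  | mul _ h₂ ih₁ _ =>
    rw [← smul_mul_assoc, ← smul_mul_assoc]
    exact .mul ih₁ h₂

/-- The Leavitt path algebra `L_K(E)`: the free `K`-algebra on the generators modulo the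
defining relations. -/
def Leavitt : Type _ := (E.leavittCon K).Quotient

namespace Leavitt

noncomputable instance : NonUnitalRing (E.Leavitt K) :=
  inferInstanceAs (NonUnitalRing (E.leavittCon K).Quotient)

/-- The quotient map from the free algebra. -/
noncomputable def mk (x : E.FreeAlg K) : E.Leavitt K := RingCon.toQuotient x

noncomputable instance : SMul K (E.Leavitt K) where
  smul c := Quotient.map' (c • ·) fun _ _ h => E.leavittCon_smul K c h

noncomputable instance : Module K (E.Leavitt K) where
  one_smul x := Quotient.inductionOn' x fun a => congrArg (mk E K) (one_smul K a)
  mul_smul c d x := Quotient.inductionOn' x fun a => congrArg (mk E K) (mul_smul c d a)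
  smul_zero c := congrArg (mk E K) (smul_zero c)
  zero_smul x := Quotient.inductionOn' x fun a => congrArg (mk E K) (zero_smul K a)
  smul_add c x y := Quotient.inductionOn₂' x y fun a b => congrArg (mk E K) (smul_add c a b)
  add_smul c d x := Quotient.inductionOn' x fun a => congrArg (mk E K) (add_smul c d a)

instance : IsScalarTower K (E.Leavitt K) (E.Leavitt K) where
  smul_assoc c x y :=
    Quotient.inductionOn₂' x y fun a b => congrArg (mk E K) (smul_mul_assoc c a b)

instance : SMulCommClass K (E.Leavitt K) (E.Leavitt K) where
  smul_comm c x y :=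
    Quotient.inductionOn₂' x y fun a b => congrArg (mk E K) (mul_smul_comm c a b).symm

end Leavitt

/-- The vertex `v` as an element of `L_K(E)`. -/
noncomputable def vertex (v : V) : E.Leavitt K := Leavitt.mk E K (E.gen K (.vertex v))

/-- The edge `e` as an element of `L_K(E)`. -/
noncomputable def edge (e : D) : E.Leavitt K := Leavitt.mk E K (E.gen K (.edge e))

/-- The ghost edge `e*` as an element of `L_K(E)`. -/
noncomputable def ghost (e : D) : E.Leavitt K := Leavitt.mk E K (E.gen K (.ghost e))

/-- The product `e₁ ⋯ eₙ` in `L_K(E)` if `n ≥ 1`, and `v` if `n = 0`. -/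
noncomputable def walkProd : V → List D → E.Leavitt K
  | v, [] => E.vertex K v
  | _, [e] => E.edge K e
  | _, e :: f :: l => E.edge K e * walkProd (E.r e) (f :: l)

/-- The product `eₙ* ⋯ e₁*` in `L_K(E)` if `n ≥ 1`, and `v` if `n = 0`. -/
noncomputable def walkStar : V → List D → E.Leavitt K
  | v, [] => E.vertex K v
  | _, [e] => E.ghost K e
  | _, e :: f :: l => walkStar (E.r e) (f :: l) * E.ghost K e

variable {E}

/-- The path `p` as an element of `L_K(E)`. -/
noncomputable def Path.elt (p : E.Path) : E.Leavitt K := E.walkProd K p.source p.edges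

/-- The ghost path `p*` as an element of `L_K(E)`. -/
noncomputable def Path.star (p : E.Path) : E.Leavitt K := E.walkStar K p.source p.edges

variable (E)

/-- The set `G_E` of all elements `p q*` of `L_K(E)`, for paths `p`, `q` with `r(p) = r(q)`. -/
def GSet : Set (E.Leavitt K) :=
  {x | ∃ p q : E.Path, p.range = q.range ∧ x = p.elt K * q.star K}

theorem vertex_mul_self (v : V) : E.vertex K v * E.vertex K v = E.vertex K v := by
  refine Quotient.sound' (RingConGen.Rel.of _ _ ⟨1, _, _, LeavittRel.vertex_mul_vertex v v, ?_, ?_⟩)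
  · exact (one_smul K _).symm
  · rw [if_pos rfl, one_smul]

variable {E}

/-- The element `p q*` of `G_E`. -/
noncomputable def GSet.pair (p q : E.Path) (h : p.range = q.range) : E.GSet K :=
  ⟨p.elt K * q.star K, p, q, h, rfl⟩

variable (E)

/-- The vertex `v` as an element of `G_E`. -/
noncomputable def GSet.ofVertex (v : V) : E.GSet K :=
  ⟨E.vertex K v, Path.nil E v, Path.nil E v, rfl, (E.vertex_mul_self K v).symm⟩

end Algebra

end DirectedGraph

/-- A trace: an additive map `t` with `t (x y) = t (y x)`. -/
def IsTrace {A T : Type*} [Add A] [Mul A] [Add T] (t : A → T) : Prop :=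
  (∀ x y, t (x + y) = t x + t y) ∧ ∀ x y, t (x * y) = t (y * x)

namespace DirectedGraph

section Conditions

variable {V : Type u} {D : Type w} (E : DirectedGraph V D) (K : Type*) [Field K]

open Classical in
/-- A map on `G_E` with `t(p q*) = δ_{p,q} t(r(p))`. -/
def IsCanonicalOnG {T : Type*} [Zero T] (t : E.GSet K → T) : Prop :=
  ∀ (p q : E.Path) (h : p.range = q.range),
    t (GSet.pair K p q h) = if p = q then t (GSet.ofVertex E K p.range) else 0

open Classical in
/-- `t(p q*) = δ_{p,q} t(r(p))` for all paths `p` and `q`. -/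
def IsCanonical {T : Type*} [Zero T] (t : E.Leavitt K → T) : Prop :=
  ∀ p q : E.Path, t (p.elt K * q.star K) = if p = q then t (E.vertex K p.range) else 0

/-- `t(p q*) = 0` for all paths `p` and `q` of different lengths. -/
def VanishesOffDegreeZero {T : Type*} [Zero T] (t : E.Leavitt K → T) : Prop :=
  ∀ p q : E.Path, p.length ≠ q.length → t (p.elt K * q.star K) = 0

/-- Gauge invariance: `t(p q*) = k^(|p|-|q|) t(p q*)` for all paths `p`, `q` and all nonzero
`k ∈ K`, where the exponent is an integer. -/
def IsGaugeInvariant {T : Type*} [SMul K T] (t : E.Leavitt K → T) : Prop :=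
  ∀ (p q : E.Path) (k : K), k ≠ 0 →
    t (p.elt K * q.star K) = k ^ ((p.length : ℤ) - (q.length : ℤ)) • t (p.elt K * q.star K)

end Conditions

end DirectedGraph

/-! Uniqueness in (a) holds because `G_E` spans: a generator times `pq*` is again of this form or
zero, so by induction every word is (`span_gset`). The values on vertices satisfy (CK2) because
`t(ee*) = t(e*e) = t(r(e))`.

Existence needs a trace on a quotient whose normal forms are not at hand. Let the generators act on
pairs (vertex, list of edges) by partial maps, `pq*` replacing an initial piece `q` by `p`. Every
word then acts as zero or as some `pq*`, and all relations except (CK2) hold, with the nowhere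
defined map as zero: `v` fixes the path of length 0 at `v`, which no `ee*` does. Send a word acting
as `pp*` to `d(r(p))` and every other word to 0. If `fg = pp*` then `gf = qq*` with `r(q) = r(p)`
(`IsMonomial.diagonal_swap`), so this is a trace on the free algebra. It respects (CK2), also after
multiplication by a word, exactly because `d` is a graph trace (`actTrace_mul_vertex_eq_sum`). Hence
it descends to `L_K(E)`.

For (b), `t(pq*) = t(q*p)`, and for paths of equal length `q*p` is `r(p)` or 0. For (c), in
characteristic zero `k = 2` already separates the degrees. -/

namespace DirectedGraph

/-! ### Concatenation of walks -/

section Walks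

variable {V : Type u} {D : Type w} (E : DirectedGraph V D)

theorem isWalk_append (v : V) (l m : List D) :
    E.IsWalk v (l ++ m) ↔ E.IsWalk v l ∧ E.IsWalk (E.walkEnd v l) m := by
  induction l generalizing v with
  | nil => simp [IsWalk, walkEnd]
  | cons e l ih => simp [IsWalk, walkEnd, ih, and_assoc]

theorem walkEnd_append (v : V) (l m : List D) :
    E.walkEnd v (l ++ m) = E.walkEnd (E.walkEnd v l) m := by
  induction l generalizing v with
  | nil => rfl
  | cons e l ih => exact ih _

variable {E}

theorem IsRegular.mem_out {v : V} (h : E.IsRegular v) {e : D} : e ∈ h.out ↔ E.s e = v := by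
  simp [IsRegular.out]

end Walks

/-! ### Products of paths and ghost paths in the Leavitt path algebra -/

section Relations

variable {V : Type u} {D : Type w} (E : DirectedGraph V D) (K : Type*) [Field K]

namespace Leavitt

theorem mk_mul (x y : E.FreeAlg K) : mk E K (x * y) = mk E K x * mk E K y := rfl

theorem mk_add (x y : E.FreeAlg K) : mk E K (x + y) = mk E K x + mk E K y := rfl

theorem mk_smul (c : K) (x : E.FreeAlg K) : mk E K (c • x) = c • mk E K x := rfl

/-- The quotient map as a linear map. -/
noncomputable def mkLinear : E.FreeAlg K →ₗ[K] E.Leavitt K where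
  toFun := mk E K
  map_add' := mk_add E K
  map_smul' := mk_smul E K

theorem mk_surjective : Function.Surjective (mk E K) := Quotient.mk''_surjective

variable {E K} in
theorem mk_eq_of_rel {x y : E.FreeAlg K} (h : E.LeavittRel K x y) : mk E K x = mk E K y :=
  Quotient.sound' (RingConGen.Rel.of _ _ ⟨1, x, y, h, (one_smul K x).symm, (one_smul K y).symm⟩)

end Leavitt

open Leavitt

theorem vertex_mul_vertex_of_ne {v w : V} (h : v ≠ w) : E.vertex K v * E.vertex K w = 0 := by
  have := mk_eq_of_rel (LeavittRel.vertex_mul_vertex (E := E) (K := K) v w)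
  rw [if_neg h] at this
  exact this

theorem source_mul_edge (e : D) : E.vertex K (E.s e) * E.edge K e = E.edge K e :=
  mk_eq_of_rel (.source_mul_edge e)

theorem edge_mul_range (e : D) : E.edge K e * E.vertex K (E.r e) = E.edge K e :=
  mk_eq_of_rel (.edge_mul_range e)

theorem range_mul_ghost (e : D) : E.vertex K (E.r e) * E.ghost K e = E.ghost K e :=
  mk_eq_of_rel (.range_mul_ghost e)

theorem ghost_mul_source (e : D) : E.ghost K e * E.vertex K (E.s e) = E.ghost K e :=
  mk_eq_of_rel (.ghost_mul_source e)

theorem ghost_mul_edge_self (e : D) : E.ghost K e * E.edge K e = E.vertex K (E.r e) := by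
  have := mk_eq_of_rel (LeavittRel.ck1 (E := E) (K := K) e e)
  rw [if_pos rfl] at this
  exact this

theorem ghost_mul_edge_of_ne {e f : D} (h : e ≠ f) : E.ghost K e * E.edge K f = 0 := by
  have := mk_eq_of_rel (LeavittRel.ck1 (E := E) (K := K) e f)
  rw [if_neg h] at this
  exact this

theorem vertex_eq_sum (v : V) (h : E.IsRegular v) :
    E.vertex K v = ∑ e ∈ h.out, E.edge K e * E.ghost K e :=
  (mk_eq_of_rel (.ck2 v h)).trans (map_sum (mkLinear E K) _ _)

/-- Since `e r(e) = e`, the one-edge case obeys the same recursion as longer walks, so later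
inductions need no separate case. -/
theorem walkProd_cons (v : V) (e : D) (l : List D) :
    E.walkProd K v (e :: l) = E.edge K e * E.walkProd K (E.r e) l := by
  cases l with
  | nil => exact (E.edge_mul_range K e).symm
  | cons f l => rfl

theorem walkStar_cons (v : V) (e : D) (l : List D) :
    E.walkStar K v (e :: l) = E.walkStar K (E.r e) l * E.ghost K e := by
  cases l with
  | nil => exact (E.range_mul_ghost K e).symm
  | cons f l => rfl

theorem vertex_mul_walkProd {v : V} {l : List D} (h : E.IsWalk v l) :
    E.vertex K v * E.walkProd K v l = E.walkProd K v l := by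
  cases l with
  | nil => exact E.vertex_mul_self K v
  | cons e l =>
    obtain ⟨rfl, -⟩ := h
    rw [walkProd_cons, ← mul_assoc, source_mul_edge]

theorem vertex_mul_walkStar (v : V) (l : List D) :
    E.vertex K (E.walkEnd v l) * E.walkStar K v l = E.walkStar K v l := by
  induction l generalizing v with
  | nil => exact E.vertex_mul_self K v
  | cons e l ih => rw [walkStar_cons, ← mul_assoc, walkEnd, ih]

theorem walkStar_concat {v : V} {l : List D} {e : D} (h : E.walkEnd v l = E.s e) :
    E.walkStar K v (l ++ [e]) = E.ghost K e * E.walkStar K v l := by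
  induction l generalizing v with
  | nil =>
    obtain rfl : v = E.s e := h
    exact (E.ghost_mul_source K e).symm
  | cons f l ih => rw [List.cons_append, walkStar_cons, ih h, walkStar_cons, mul_assoc]

theorem walkStar_mul_walkProd_self {v : V} {l : List D} (h : E.IsWalk v l) :
    E.walkStar K v l * E.walkProd K v l = E.vertex K (E.walkEnd v l) := by
  induction l generalizing v with
  | nil => exact E.vertex_mul_self K v
  | cons e l ih =>
    rw [walkStar_cons, walkProd_cons, mul_assoc, ← mul_assoc (E.ghost K e), ghost_mul_edge_self,
      vertex_mul_walkProd E K h.2, ih h.2, walkEnd]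

/-- The first edges meet in the middle and cancel by (CK1). Equal lengths ensure that the
cancellation reaches either two distinct edges or two distinct vertices. -/
theorem walkStar_mul_walkProd_of_ne {v w : V} {l m : List D} (hl : E.IsWalk v l)
    (hm : E.IsWalk w m) (hlen : l.length = m.length) (hne : (v, l) ≠ (w, m)) :
    E.walkStar K v l * E.walkProd K w m = 0 := by
  induction l generalizing v w m with
  | nil =>
    obtain rfl : m = [] := List.length_eq_zero_iff.1 hlen.symm
    exact E.vertex_mul_vertex_of_ne K fun h => hne (by rw [h])
  | cons e l ih =>
    cases m with
    | nil => simp at hlen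
    | cons f m =>
      rw [walkStar_cons, walkProd_cons, mul_assoc, ← mul_assoc (E.ghost K e)]
      by_cases hef : e = f
      · subst hef
        rw [ghost_mul_edge_self, vertex_mul_walkProd E K hm.2]
        refine ih hl.2 hm.2 (by simpa using hlen) fun h => hne ?_
        obtain rfl : l = m := congrArg Prod.snd h
        rw [← hl.1, ← hm.1]
      · rw [ghost_mul_edge_of_ne E K hef, zero_mul, mul_zero]

variable {E}

theorem Path.star_mul_elt_self (p : E.Path) : p.star K * p.elt K = E.vertex K p.range :=
  E.walkStar_mul_walkProd_self K p.isWalk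

theorem Path.star_mul_elt_of_ne {p q : E.Path} (hlen : p.length = q.length) (h : p ≠ q) :
    p.star K * q.elt K = 0 :=
  E.walkStar_mul_walkProd_of_ne K p.isWalk q.isWalk hlen fun h' =>
    h (Path.ext (congrArg Prod.fst h') (congrArg Prod.snd h'))

end Relations

end DirectedGraph

/-! ### Canonical traces, degree and gauge invariance -/

section Traces

theorem IsTrace.map_zero {A T : Type*} [AddMonoid A] [Mul A] [AddGroup T] {t : A → T}
    (h : IsTrace t) : t 0 = 0 := by
  simpa using h.1 0 0

end Traces

namespace DirectedGraph

section Conditions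

variable {V : Type u} {D : Type w} {E : DirectedGraph V D} {K : Type*} [Field K]

theorem IsCanonical.vanishesOffDegreeZero {S : Type*} [Zero S] {t : E.Leavitt K → S}
    (h : E.IsCanonical K t) : E.VanishesOffDegreeZero K t := fun p q hpq => by
  rw [h p q, if_neg]
  rintro rfl
  exact hpq rfl

theorem VanishesOffDegreeZero.isCanonical {S : Type*} [AddGroup S] {t : E.Leavitt K → S}
    (ht : IsTrace t) (h : E.VanishesOffDegreeZero K t) : E.IsCanonical K t := fun p q => by
  by_cases hpq : p = q
  · subst hpq
    rw [if_pos rfl, ht.2, p.star_mul_elt_self K]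
  · rw [if_neg hpq]
    by_cases hlen : q.length = p.length
    · rw [ht.2, Path.star_mul_elt_of_ne K hlen (Ne.symm hpq), ht.map_zero]
    · exact h p q (Ne.symm hlen)

theorem VanishesOffDegreeZero.isGaugeInvariant {T : Type*} [AddCommGroup T] [Module K T]
    {t : E.Leavitt K → T} (h : E.VanishesOffDegreeZero K t) : E.IsGaugeInvariant K t :=
  fun p q k _ => by
    by_cases hlen : p.length = q.length
    · rw [hlen, sub_self, zpow_zero, one_smul]
    · rw [h p q hlen, smul_zero]

theorem IsGaugeInvariant.vanishesOffDegreeZero [CharZero K] {T : Type*} [AddCommGroup T]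
    [Module K T] {t : E.Leavitt K → T} (h : E.IsGaugeInvariant K t) :
    E.VanishesOffDegreeZero K t := fun p q hlen => by
  by_contra hne
  have hk : (1 - (2 : K) ^ ((p.length : ℤ) - (q.length : ℤ))) • t (p.elt K * q.star K) = 0 := by
    rw [sub_smul, one_smul, ← h p q 2 two_ne_zero, sub_self]
  have h1 := sub_eq_zero.1 ((smul_eq_zero.1 hk).resolve_right hne)
  -- `K` carries no order, so the equation is pulled back to ℚ, where a power of 2 equals 1 only for
  -- exponent 0.
  have h2 : (2 : ℚ) ^ ((p.length : ℤ) - (q.length : ℤ)) = 1 := by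
    apply (algebraMap ℚ K).injective
    rw [map_zpow₀, map_ofNat, map_one, ← h1]
  have h3 := (zpow_eq_one_iff_right₀ (a := (2 : ℚ)) (by norm_num) (by norm_num)).1 h2
  omega

end Conditions

end DirectedGraph
namespace DirectedGraph

/-! ### Partial maps on paths and the trace function on monomials -/

section Action

variable {V : Type u} {D : Type w}

/-- Partial maps of `V × List D` into itself, as a monoid under composition. -/
abbrev PartialAct (V : Type u) (D : Type w) : Type (max u w) :=
  Function.End (Option (V × List D))

/-- The empty partial map. -/
def nullAct : PartialAct V D := fun _ => none

open Classical in
/-- The action of `p q*` for `p = (v, l)`, `q = (w, m)`: it replaces the initial piece `q` of a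
path by `p`. -/
noncomputable def pairAct (v : V) (l : List D) (w : V) (m : List D) : PartialAct V D := fun o =>
  o.bind fun x => if x.1 = w ∧ m <+: x.2 then some (v, l ++ x.2.drop m.length) else none

/-- Describes the graph of the partial map by common tails `k`; the product formulas below reduce to
comparing such tails. -/
theorem pairAct_eq_some_iff {v w : V} {l m : List D} {o : Option (V × List D)} {y : V × List D} :
    pairAct v l w m o = some y ↔ ∃ k, o = some (w, m ++ k) ∧ y = (v, l ++ k) := by
  simp only [pairAct, Option.bind_eq_some_iff]
  constructor
  · rintro ⟨⟨x, n⟩, rfl, h⟩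
    split_ifs at h with hx
    obtain ⟨rfl, k, rfl⟩ := hx
    exact ⟨k, rfl, by simpa using h.symm⟩
  · rintro ⟨k, rfl, rfl⟩
    exact ⟨_, rfl, by simp⟩

theorem pairAct_self (v : V) (l : List D) (w : V) (m : List D) :
    pairAct v l w m (some (w, m)) = some (v, l) :=
  pairAct_eq_some_iff.2 ⟨[], by simp, by simp⟩

theorem partialAct_ext {f g : PartialAct V D} (h : ∀ o y, f o = some y ↔ g o = some y) : f = g :=
  funext fun o => Option.ext (h o)

theorem pairAct_ne_nullAct (v : V) (l : List D) (w : V) (m : List D) :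
    pairAct v l w m ≠ nullAct := fun h => by
  simpa [h, nullAct] using pairAct_self v l w m

theorem nullAct_mul (f : PartialAct V D) : nullAct * f = nullAct := rfl

theorem pairAct_mul_of_left_prefix (v : V) (l : List D) (w : V) (m k : List D) (u : V)
    (n : List D) : pairAct v l w m * pairAct w (m ++ k) u n = pairAct v (l ++ k) u n := by
  refine partialAct_ext fun o y => ?_
  change pairAct v l w m (pairAct w (m ++ k) u n o) = _ ↔ _
  simp only [pairAct_eq_some_iff]
  constructor
  · rintro ⟨a, ⟨b, rfl, h⟩, rfl⟩
    obtain rfl : a = k ++ b := by simpa using h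
    exact ⟨b, rfl, by simp⟩
  · rintro ⟨b, rfl, rfl⟩
    exact ⟨k ++ b, ⟨b, rfl, by simp⟩, by simp⟩

theorem pairAct_mul_of_right_prefix (v : V) (l : List D) (w : V) (m k : List D) (u : V)
    (n : List D) : pairAct v l w (m ++ k) * pairAct w m u n = pairAct v l u (n ++ k) := by
  refine partialAct_ext fun o y => ?_
  change pairAct v l w (m ++ k) (pairAct w m u n o) = _ ↔ _
  simp only [pairAct_eq_some_iff]
  constructor
  · rintro ⟨a, ⟨b, rfl, h⟩, rfl⟩
    obtain rfl : k ++ a = b := by simpa using h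
    exact ⟨a, by simp, rfl⟩
  · rintro ⟨b, rfl, rfl⟩
    exact ⟨b, ⟨k ++ b, by simp, by simp⟩, rfl⟩

theorem pairAct_mul_self (v : V) (l : List D) (w : V) (m : List D) (u : V) (n : List D) :
    pairAct v l w m * pairAct w m u n = pairAct v l u n := by
  simpa using pairAct_mul_of_left_prefix v l w m [] u n

/-- A product of two actions is nonzero only if one of the two matching paths is an initial
piece of the other one. -/
theorem exists_prefix_of_pairAct_mul_ne {v w w' u : V} {l m m' n : List D}
    (h : pairAct v l w m * pairAct w' m' u n ≠ nullAct) :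
    w = w' ∧ ((∃ k, m' = m ++ k) ∨ ∃ k, m = m' ++ k) := by
  by_contra hc
  refine h (partialAct_ext fun o y => ?_)
  change pairAct v l w m (pairAct w' m' u n o) = _ ↔ _
  simp only [pairAct_eq_some_iff, nullAct, reduceCtorEq, iff_false]
  rintro ⟨a, ⟨b, rfl, h⟩, rfl⟩
  obtain ⟨rfl, h⟩ := Prod.ext_iff.1 h
  refine hc ⟨rfl, ?_⟩
  rcases List.append_eq_append_iff.1 h with ⟨k, hk, -⟩ | ⟨k, hk, -⟩
  · exact .inl ⟨k, hk⟩
  · exact .inr ⟨k, hk⟩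

/-- A projection determines its path, so its trace value does not depend on the chosen
representation. Evaluating both sides at `(w, m)` and at `(u, n)` shows that `m` and `n` are initial
pieces of each other. -/
theorem pairAct_eq_diagonal {v w u : V} {l m n : List D}
    (h : pairAct v l w m = pairAct u n u n) : v = u ∧ l = n ∧ w = u ∧ m = n := by
  obtain ⟨k, h1, h2⟩ := pairAct_eq_some_iff.1 ((congrFun h _).symm.trans (pairAct_self v l w m))
  obtain ⟨k', h3, -⟩ := pairAct_eq_some_iff.1 ((congrFun h _).trans (pairAct_self u n u n))
  simp only [Option.some.injEq, Prod.mk.injEq] at h1 h2 h3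
  obtain ⟨rfl, h1⟩ := h1
  obtain ⟨rfl, h2⟩ := h2
  have hk : k = [] := by
    have := congrArg List.length h1
    have := congrArg List.length h3.2
    simp only [List.length_append] at *
    exact List.length_eq_zero_iff.1 (by omega)
  subst hk
  exact ⟨rfl, by simpa using h2, rfl, by simpa using h1⟩

variable (E : DirectedGraph V D)

/-- The action of the generators on paths. -/
noncomputable def genAct : Gen V D → PartialAct V D
  | .vertex v => pairAct v [] v []
  | .edge e => pairAct (E.s e) [e] (E.r e) []
  | .ghost e => pairAct (E.r e) [] (E.s e) [e]

/-- The action of the words in the generators on paths. -/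
noncomputable def act : FreeSemigroup (Gen V D) →ₙ* PartialAct V D :=
  FreeSemigroup.lift E.genAct

/-- The partial maps which are zero or of the form `p q*` for paths `p`, `q` with the same
range. -/
inductive IsMonomial : PartialAct V D → Prop
  | null : IsMonomial nullAct
  | pair (v : V) (l : List D) (w : V) (m : List D) (hl : E.IsWalk v l) (hm : E.IsWalk w m)
      (h : E.walkEnd v l = E.walkEnd w m) : IsMonomial (pairAct v l w m)

variable {E}

theorem IsMonomial.mul {f g : PartialAct V D} (hf : E.IsMonomial f) (hg : E.IsMonomial g) :
    E.IsMonomial (f * g) := by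
  cases hf with
  | null => exact .null
  | pair v l w m hl hm h =>
    cases hg with
    | null => exact .null
    | pair w' m' u n hm' hn h' =>
      by_cases h0 : pairAct v l w m * pairAct w' m' u n = nullAct
      · rw [h0]
        exact .null
      · obtain ⟨rfl, ⟨k, rfl⟩ | ⟨k, rfl⟩⟩ := exists_prefix_of_pairAct_mul_ne h0
        · rw [pairAct_mul_of_left_prefix]
          rw [isWalk_append, ← h] at hm'
          rw [walkEnd_append, ← h] at h'
          exact .pair _ _ _ _ ((E.isWalk_append _ _ _).2 ⟨hl, hm'.2⟩) hn
            (by rw [walkEnd_append, h'])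
        · rw [pairAct_mul_of_right_prefix]
          rw [isWalk_append, h'] at hm
          rw [walkEnd_append, h'] at h
          exact .pair _ _ _ _ hl ((E.isWalk_append _ _ _).2 ⟨hn, hm.2⟩)
            (by rw [walkEnd_append, h])

theorem IsMonomial.genAct (x : Gen V D) : E.IsMonomial (E.genAct x) := by
  cases x with
  | vertex v => exact .pair _ _ _ _ trivial trivial rfl
  | edge e => exact .pair _ _ _ _ ⟨rfl, trivial⟩ trivial rfl
  | ghost e => exact .pair _ _ _ _ trivial ⟨rfl, trivial⟩ rfl

theorem IsMonomial.act (x : FreeSemigroup (Gen V D)) : E.IsMonomial (E.act x) := by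
  induction x using FreeSemigroup.recOnMul with
  | ih1 x => exact .genAct x
  | ih2 x y hx hy =>
    rw [map_mul]
    exact hx.mul hy

/-- If `f g` is a projection `p p*`, then `g f` is a projection `q q*` and `r(p) = r(q)`. -/
theorem IsMonomial.diagonal_swap {f g : PartialAct V D} (hf : E.IsMonomial f)
    (hg : E.IsMonomial g) {a : V} {c : List D} (h : f * g = pairAct a c a c) :
    ∃ b d, E.IsWalk b d ∧ g * f = pairAct b d b d ∧ E.walkEnd b d = E.walkEnd a c := by
  cases hf with
  | null => exact absurd h.symm (pairAct_ne_nullAct _ _ _ _)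
  | pair v l w m hl hm hlm =>
    cases hg with
    | null => exact absurd h.symm (pairAct_ne_nullAct _ _ _ _)
    | pair w' m' u n hm' hn hmn =>
      obtain ⟨rfl, ⟨k, rfl⟩ | ⟨k, rfl⟩⟩ :=
        exists_prefix_of_pairAct_mul_ne (h ▸ pairAct_ne_nullAct _ _ _ _)
      · rw [pairAct_mul_of_left_prefix] at h
        obtain ⟨rfl, rfl, rfl, rfl⟩ := pairAct_eq_diagonal h
        exact ⟨_, _, hm', pairAct_mul_of_right_prefix .., hmn⟩
      · rw [pairAct_mul_of_right_prefix] at h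
        obtain ⟨rfl, rfl, rfl, rfl⟩ := pairAct_eq_diagonal h
        exact ⟨_, _, hm, pairAct_mul_of_left_prefix .., hlm.symm⟩

variable (E)

open Classical in
/-- The value `d(r(p))` at the projection `p p*`, and `0` at the other partial maps. -/
noncomputable def actTrace {T : Type*} [Zero T] (d : V → T) (f : PartialAct V D) : T :=
  if h : ∃ x : V × List D, E.IsWalk x.1 x.2 ∧ f = pairAct x.1 x.2 x.1 x.2 then
    d (E.walkEnd h.choose.1 h.choose.2) else 0

section Trace

variable {T : Type*} [Zero T] (d : V → T)

theorem actTrace_diagonal {v : V} {l : List D} (h : E.IsWalk v l) :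
    E.actTrace d (pairAct v l v l) = d (E.walkEnd v l) := by
  have hex : ∃ x : V × List D, E.IsWalk x.1 x.2 ∧
      pairAct v l v l = pairAct x.1 x.2 x.1 x.2 := ⟨(v, l), h, rfl⟩
  obtain ⟨h1, h2, -⟩ := pairAct_eq_diagonal hex.choose_spec.2
  rw [actTrace, dif_pos hex, ← h1, ← h2]

theorem actTrace_eq_zero {f : PartialAct V D} (h : ∀ v l, f ≠ pairAct v l v l) :
    E.actTrace d f = 0 :=
  dif_neg fun ⟨x, _, hx⟩ => h x.1 x.2 hx

theorem actTrace_nullAct : E.actTrace d nullAct = 0 :=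
  E.actTrace_eq_zero d fun _ _ => (pairAct_ne_nullAct _ _ _ _).symm

theorem actTrace_pairAct_of_ne {v w : V} {l m : List D} (h : (v, l) ≠ (w, m)) :
    E.actTrace d (pairAct v l w m) = 0 :=
  E.actTrace_eq_zero d fun u n hun => by
    obtain ⟨rfl, rfl, rfl, rfl⟩ := pairAct_eq_diagonal hun
    exact h rfl

variable {E}

/-- The trace property at the level of monomials: interchanging the factors preserves being a
projection as well as the range of its path. -/
theorem IsMonomial.actTrace_mul_comm {f g : PartialAct V D} (hf : E.IsMonomial f)
    (hg : E.IsMonomial g) : E.actTrace d (f * g) = E.actTrace d (g * f) := by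
  by_cases h : ∃ v l, f * g = pairAct v l v l
  · obtain ⟨v, l, h⟩ := h
    obtain ⟨w, m, hm, h', hr⟩ := hf.diagonal_swap hg h
    -- Swapping back represents `f * g` by a genuine walk, which is not known of `(v, l)`.
    obtain ⟨u, n, hn, h'', hr'⟩ := hg.diagonal_swap hf h'
    rw [h', h'', actTrace_diagonal E d hn, actTrace_diagonal E d hm, hr']
  · rw [E.actTrace_eq_zero d fun v l hv => h ⟨v, l, hv⟩, E.actTrace_eq_zero d fun v l hv => ?_]
    obtain ⟨w, m, -, h', -⟩ := hg.diagonal_swap hf hv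
    exact h ⟨w, m, h'⟩

end Trace

end Action

end DirectedGraph
namespace DirectedGraph

/-! ### The trace on the free algebra and its descent to the quotient -/

section Extension

variable {V : Type u} {D : Type w} (E : DirectedGraph V D) (K : Type*) [Field K]
variable {T : Type*} [AddCommGroup T] [Module K T] (d : V → T)

/-- The linear extension of `x ↦ actTrace d (f * act x)` to the free algebra. -/
noncomputable def freeTrace (f : PartialAct V D) : E.FreeAlg K →ₗ[K] T :=
  (Finsupp.linearCombination K fun x => E.actTrace d (f * E.act x)) ∘ₗ
    (MonoidAlgebra.coeffLinearEquiv K).toLinearMap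

theorem freeTrace_single (f : PartialAct V D) (x : FreeSemigroup (Gen V D)) (c : K) :
    E.freeTrace K d f (MonoidAlgebra.single x c) = c • E.actTrace d (f * E.act x) :=
  Finsupp.linearCombination_single K c x

theorem freeTrace_gen (f : PartialAct V D) (a : Gen V D) :
    E.freeTrace K d f (E.gen K a) = E.actTrace d (f * E.genAct a) := by
  rw [gen, freeTrace_single, one_smul]
  rfl

theorem freeTrace_gen_mul_gen (f : PartialAct V D) (a b : Gen V D) :
    E.freeTrace K d f (E.gen K a * E.gen K b) =
      E.actTrace d (f * (E.genAct a * E.genAct b)) := by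
  rw [gen, gen, MonoidAlgebra.single_mul_single, freeTrace_single, mul_one, one_smul, map_mul]
  rfl

/-- The parameter `f` absorbs left factors, so a relation multiplied by a word can be checked as the
bare relation with another `f`. -/
theorem freeTrace_single_mul (f : PartialAct V D) (x : FreeSemigroup (Gen V D)) (c : K)
    (y : E.FreeAlg K) : E.freeTrace K d f (MonoidAlgebra.single x c * y) =
      c • E.freeTrace K d (f * E.act x) y := by
  induction y using MonoidAlgebra.induction_linear with
  | zero => simp
  | add y z hy hz => rw [mul_add, map_add, map_add, hy, hz, smul_add]
  | single y c' =>
    rw [MonoidAlgebra.single_mul_single, freeTrace_single, freeTrace_single, map_mul, mul_smul,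
      mul_assoc]

theorem freeTrace_mul_comm (x y : E.FreeAlg K) :
    E.freeTrace K d 1 (x * y) = E.freeTrace K d 1 (y * x) := by
  induction x using MonoidAlgebra.induction_linear with
  | zero => simp
  | add x z hx hz => rw [mul_add, add_mul, map_add, map_add, hx, hz]
  | single x c =>
    induction y using MonoidAlgebra.induction_linear with
    | zero => simp
    | add y z hy hz => rw [mul_add, add_mul, map_add, map_add, hy, hz]
    | single y c' =>
      rw [MonoidAlgebra.single_mul_single, MonoidAlgebra.single_mul_single, freeTrace_single,
        freeTrace_single, one_mul, one_mul, map_mul, map_mul,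
        (IsMonomial.act x).actTrace_mul_comm d (.act y), mul_comm]

variable {E d} in
-- Invariance under (CK2), the one relation that fails for the partial maps themselves. For `f =
-- pq*` with `q` starting at `v` and of positive length, only the first edge of `q` contributes, and
-- its `ee*` is absorbed. If `q = v`, both sides vanish unless `p = v`, and then the claim is the
-- graph trace equation.
theorem actTrace_mul_vertex_eq_sum (hd : E.IsGraphTrace d) {f : PartialAct V D}
    (hf : E.IsMonomial f) (v : V) (h : E.IsRegular v) :
    E.actTrace d (f * pairAct v [] v []) =
      ∑ e ∈ h.out, E.actTrace d (f * pairAct v [e] v [e]) := by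
  cases hf with
  | null => simp [nullAct_mul, actTrace_nullAct]
  | pair a l b m hl hm hlm =>
    by_cases hb : b = v
    · subst hb
      cases m with
      | nil =>
        have hprod (e : D) : pairAct a l b [] * pairAct b [e] b [e] =
            pairAct a (l ++ [e]) b [e] := pairAct_mul_of_left_prefix a l b [] [e] b [e]
        simp only [pairAct_mul_self, hprod]
        by_cases hal : (a, l) = (b, [])
        · obtain ⟨rfl, rfl⟩ := Prod.mk.inj hal
          rw [actTrace_diagonal E d hl]
          refine (hd a h).trans (Finset.sum_congr rfl fun e he => ?_)
          exact (actTrace_diagonal E d (l := [e]) ⟨h.mem_out.1 he, trivial⟩).symm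
        · rw [actTrace_pairAct_of_ne E d hal]
          refine (Finset.sum_eq_zero fun e _ => actTrace_pairAct_of_ne E d fun hc => hal ?_).symm
          simpa using hc
      | cons f m =>
        have hv : pairAct a l b (f :: m) * pairAct b [] b [] = pairAct a l b (f :: m) :=
          pairAct_mul_of_right_prefix a l b [] (f :: m) b []
        have hf : pairAct a l b (f :: m) * pairAct b [f] b [f] = pairAct a l b (f :: m) :=
          pairAct_mul_of_right_prefix a l b [f] m b [f]
        rw [hv, Finset.sum_eq_single f, hf]
        · intro e _ hne
          rw [← E.actTrace_nullAct d]
          congr 1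
          by_contra h0
          obtain ⟨-, ⟨k, hk⟩ | ⟨k, hk⟩⟩ := exists_prefix_of_pairAct_mul_ne h0
          · exact hne (by simpa using congrArg List.head? hk)
          · exact hne (by simpa using (congrArg List.head? hk).symm)
        · exact fun hc => absurd (h.mem_out.2 hm.1) hc
    · have hnull (c : List D) : pairAct a l b m * pairAct v c v c = nullAct := by
        by_contra h0
        exact hb (exists_prefix_of_pairAct_mul_ne h0).1
      simp [hnull, actTrace_nullAct]

variable {E K d} in
theorem freeTrace_eq_of_rel (hd : E.IsGraphTrace d) {x y : E.FreeAlg K}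
    (h : E.LeavittRel K x y) {f : PartialAct V D} (hf : f = 1 ∨ E.IsMonomial f) :
    E.freeTrace K d f x = E.freeTrace K d f y := by
  -- An arbitrary self-map of the option type may move `none`; the identity and the monomials fix
  -- it.
  have hnull : E.actTrace d (f * nullAct) = 0 := by
    rcases hf with rfl | hf
    · exact E.actTrace_nullAct d
    · cases hf with
      | null => exact E.actTrace_nullAct d
      | pair => exact E.actTrace_nullAct d
  cases h with
  | vertex_mul_vertex v w =>
    rw [freeTrace_gen_mul_gen]
    split_ifs with hvw
    · subst hvw
      rw [freeTrace_gen, genAct, pairAct_mul_self]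
    · rw [map_zero, ← hnull]
      congr 2
      by_contra h0
      exact hvw (exists_prefix_of_pairAct_mul_ne h0).1
  | source_mul_edge e =>
    rw [freeTrace_gen_mul_gen, freeTrace_gen]
    exact congrArg (fun g => E.actTrace d (f * g)) (pairAct_mul_of_left_prefix _ [] _ [] [e] _ _)
  | edge_mul_range e =>
    rw [freeTrace_gen_mul_gen, freeTrace_gen]
    exact congrArg (fun g => E.actTrace d (f * g)) (pairAct_mul_self _ _ _ _ _ _)
  | range_mul_ghost e =>
    rw [freeTrace_gen_mul_gen, freeTrace_gen]
    exact congrArg (fun g => E.actTrace d (f * g)) (pairAct_mul_self _ _ _ _ _ _)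
  | ghost_mul_source e =>
    rw [freeTrace_gen_mul_gen, freeTrace_gen]
    exact congrArg (fun g => E.actTrace d (f * g))
      (pairAct_mul_of_right_prefix _ _ _ [] [e] _ [])
  | ck1 e g =>
    rw [freeTrace_gen_mul_gen]
    split_ifs with heg
    · subst heg
      rw [freeTrace_gen]
      exact congrArg (fun g => E.actTrace d (f * g)) (pairAct_mul_self _ _ _ _ _ _)
    · rw [map_zero, ← hnull]
      congr 2
      by_contra h0
      obtain ⟨-, ⟨k, hk⟩ | ⟨k, hk⟩⟩ := exists_prefix_of_pairAct_mul_ne h0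
      · exact heg (by simpa using (congrArg List.head? hk).symm)
      · exact heg (by simpa using congrArg List.head? hk)
  | ck2 v h =>
    have hpair : ∀ e ∈ h.out, E.genAct (.edge e) * E.genAct (.ghost e) =
        pairAct v [e] v [e] := fun e he => by
      obtain rfl := h.mem_out.1 he
      exact pairAct_mul_self _ _ _ _ _ _
    rw [map_sum, freeTrace_gen]
    refine Eq.trans ?_ (Finset.sum_congr rfl fun e he => by
      rw [freeTrace_gen_mul_gen, hpair e he]).symm
    rcases hf with rfl | hf
    -- The identity is not given as a monomial, but `v` may replace it as left factor, since it
    -- fixes `v` and each `ee*` with `s(e) = v`.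
    · have := actTrace_mul_vertex_eq_sum hd (IsMonomial.genAct (.vertex v)) v h
      have hprod (e : D) : pairAct v [] v [] * pairAct v [e] v [e] = pairAct v [e] v [e] :=
        pairAct_mul_of_left_prefix v [] v [] [e] v [e]
      simpa only [genAct, pairAct_mul_self, hprod, one_mul] using this
    · exact actTrace_mul_vertex_eq_sum hd hf v h

variable {E K d} in
theorem freeTrace_mul_eq_of_rel (hd : E.IsGraphTrace d) {x y : E.FreeAlg K}
    (h : E.LeavittRel K x y) (z : E.FreeAlg K) :
    E.freeTrace K d 1 (z * x) = E.freeTrace K d 1 (z * y) := by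
  induction z using MonoidAlgebra.induction_linear with
  | zero => simp
  | add z z' hz hz' => rw [add_mul, add_mul, map_add, map_add, hz, hz']
  | single z c =>
    rw [freeTrace_single_mul, freeTrace_single_mul, one_mul,
      freeTrace_eq_of_rel hd h (.inr (.act z))]

variable {E K d} in
theorem freeTrace_eq_of_con (hd : E.IsGraphTrace d) {x y : E.FreeAlg K}
    (h : E.leavittCon K x y) : E.freeTrace K d 1 x = E.freeTrace K d 1 y := by
  -- The induction must carry left multiples to handle products; right multiples then follow from
  -- the trace property. The bare equation is kept separately because the free algebra has no unit.
  suffices E.freeTrace K d 1 x = E.freeTrace K d 1 y ∧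
      ∀ z, E.freeTrace K d 1 (z * x) = E.freeTrace K d 1 (z * y) from this.1
  change RingConGen.Rel _ x y at h
  induction h with
  | of x y h =>
    obtain ⟨c, a, b, hab, rfl, rfl⟩ := h
    refine ⟨?_, fun z => ?_⟩
    · rw [map_smul, map_smul, freeTrace_eq_of_rel hd hab (.inl rfl)]
    · rw [mul_smul_comm, mul_smul_comm, map_smul, map_smul, freeTrace_mul_eq_of_rel hd hab]
  | refl x => exact ⟨rfl, fun _ => rfl⟩
  | symm _ ih => exact ⟨ih.1.symm, fun z => (ih.2 z).symm⟩
  | trans _ _ ih ih' => exact ⟨ih.1.trans ih'.1, fun z => (ih.2 z).trans (ih'.2 z)⟩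
  | add _ _ ih ih' =>
    refine ⟨?_, fun z => ?_⟩
    · rw [map_add, map_add, ih.1, ih'.1]
    · rw [mul_add, mul_add, map_add, map_add, ih.2, ih'.2]
  | mul _ _ ih ih' =>
    refine ⟨?_, fun z => ?_⟩
    · rw [ih'.2, freeTrace_mul_comm, ih.2, freeTrace_mul_comm]
    · rw [← mul_assoc, ih'.2, freeTrace_mul_comm, ← mul_assoc, ih.2, mul_assoc,
        freeTrace_mul_comm, mul_assoc]

variable {E d} in
/-- The trace on the Leavitt path algebra given by a graph trace. -/
noncomputable def canonicalTrace (hd : E.IsGraphTrace d) : E.Leavitt K →ₗ[K] T where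
  toFun := Quotient.lift (E.freeTrace K d 1) fun _ _ h => freeTrace_eq_of_con hd h
  map_add' x y := Quotient.inductionOn₂' x y fun a b => map_add (E.freeTrace K d 1) a b
  map_smul' c x := Quotient.inductionOn' x fun a => map_smul (E.freeTrace K d 1) c a

variable {E d}

theorem canonicalTrace_mk (hd : E.IsGraphTrace d) (x : E.FreeAlg K) :
    canonicalTrace K hd (Leavitt.mk E K x) = E.freeTrace K d 1 x := rfl

theorem isTrace_canonicalTrace (hd : E.IsGraphTrace d) : IsTrace (canonicalTrace K hd) :=
  ⟨map_add _, fun x y => by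
    obtain ⟨x, rfl⟩ := Leavitt.mk_surjective E K x
    obtain ⟨y, rfl⟩ := Leavitt.mk_surjective E K y
    exact E.freeTrace_mul_comm K d x y⟩

variable (E)

/-- The canonical trace is evaluated on words, so a path has to be exhibited as the class of one
word with known action. -/
theorem exists_word_walkProd {v : V} {l : List D} (h : E.IsWalk v l) :
    ∃ x : FreeSemigroup (Gen V D), E.walkProd K v l = Leavitt.mk E K (.single x 1) ∧
      E.act x = pairAct v l (E.walkEnd v l) [] := by
  induction l generalizing v with
  | nil => exact ⟨.of (.vertex v), rfl, rfl⟩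
  | cons e l ih =>
    obtain ⟨rfl, h⟩ := h
    obtain ⟨x, hx, hx'⟩ := ih h
    refine ⟨.of (.edge e) * x, ?_, ?_⟩
    · rw [walkProd_cons, hx, edge, gen, ← Leavitt.mk_mul, MonoidAlgebra.single_mul_single,
        mul_one]
    · rw [map_mul, hx']
      exact pairAct_mul_of_left_prefix _ [e] _ [] l _ _

theorem exists_word_walkStar {v : V} {l : List D} (h : E.IsWalk v l) :
    ∃ x : FreeSemigroup (Gen V D), E.walkStar K v l = Leavitt.mk E K (.single x 1) ∧
      E.act x = pairAct (E.walkEnd v l) [] v l := by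
  induction l generalizing v with
  | nil => exact ⟨.of (.vertex v), rfl, rfl⟩
  | cons e l ih =>
    obtain ⟨rfl, h⟩ := h
    obtain ⟨x, hx, hx'⟩ := ih h
    refine ⟨x * .of (.ghost e), ?_, ?_⟩
    · rw [walkStar_cons, hx, ghost, gen, ← Leavitt.mk_mul, MonoidAlgebra.single_mul_single,
        mul_one]
    · rw [map_mul, hx']
      exact pairAct_mul_of_right_prefix _ [] _ [] l _ [e]

open Classical in
theorem canonicalTrace_elt_mul_star {E : DirectedGraph V D} (hd : E.IsGraphTrace d)
    (p q : E.Path) (h : p.range = q.range) :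
    canonicalTrace K hd (p.elt K * q.star K) = if p = q then d p.range else 0 := by
  obtain ⟨x, hx, hx'⟩ := E.exists_word_walkProd K p.isWalk
  obtain ⟨y, hy, hy'⟩ := E.exists_word_walkStar K q.isWalk
  have h' : E.walkEnd p.source p.edges = E.walkEnd q.source q.edges := h
  rw [Path.elt, Path.star, hx, hy, ← Leavitt.mk_mul, canonicalTrace_mk,
    MonoidAlgebra.single_mul_single, freeTrace_single, mul_one, one_smul, one_mul, map_mul, hx',
    hy', h', pairAct_mul_self]
  split_ifs with hpq
  · subst hpq
    exact E.actTrace_diagonal d p.isWalk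
  · exact E.actTrace_pairAct_of_ne d fun hc =>
      hpq (Path.ext (congrArg Prod.fst hc) (congrArg Prod.snd hc))

end Extension

/-! ### The elements `pq*` span -/

section Span

variable {V : Type u} {D : Type w} (E : DirectedGraph V D) (K : Type*) [Field K]

theorem gen_mul_mem_gset_or_eq_zero (a : Gen V D) {x : E.Leavitt K} (hx : x ∈ E.GSet K) :
    Leavitt.mk E K (E.gen K a) * x ∈ E.GSet K ∨ Leavitt.mk E K (E.gen K a) * x = 0 := by
  obtain ⟨⟨v, l, hl⟩, ⟨w, m, hm⟩, h, rfl⟩ := hx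
  rw [← mul_assoc]
  cases a with
  | vertex u =>
    change E.vertex K u * E.walkProd K v l * _ ∈ _ ∨ E.vertex K u * E.walkProd K v l * _ = _
    by_cases huv : u = v
    · subst huv
      rw [vertex_mul_walkProd E K hl]
      exact .inl ⟨⟨u, l, hl⟩, ⟨w, m, hm⟩, h, rfl⟩
    · rw [← vertex_mul_walkProd E K hl, ← mul_assoc, E.vertex_mul_vertex_of_ne K huv, zero_mul]
      exact .inr (zero_mul _)
  | edge e =>
    change E.edge K e * E.walkProd K v l * _ ∈ _ ∨ E.edge K e * E.walkProd K v l * _ = _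
    by_cases hev : E.r e = v
    · subst hev
      rw [← walkProd_cons E K (E.s e)]
      exact .inl ⟨⟨E.s e, e :: l, rfl, hl⟩, ⟨w, m, hm⟩, h, rfl⟩
    · rw [← vertex_mul_walkProd E K hl, ← edge_mul_range, mul_assoc (E.edge K e),
        ← mul_assoc (E.vertex K _) (E.vertex K _), E.vertex_mul_vertex_of_ne K hev, zero_mul,
        mul_zero]
      exact .inr (zero_mul _)
  | ghost e =>
    change E.ghost K e * E.walkProd K v l * E.walkStar K w m ∈ _ ∨
      E.ghost K e * E.walkProd K v l * _ = _
    cases l with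
    | nil =>
      by_cases hev : E.s e = v
      · subst hev
        have hm' : E.walkEnd w m = E.s e := h.symm
        -- With `p` a vertex nothing cancels: `e*` is absorbed on the other side, as `e* q* =
        -- (qe)*`.
        rw [walkProd, ghost_mul_source, ← walkStar_concat E K hm']
        refine .inl ⟨.nil E (E.r e), ⟨w, m ++ [e], (E.isWalk_append _ _ _).2
          ⟨hm, hm'.symm, trivial⟩⟩, (E.walkEnd_append w m [e]).symm, ?_⟩
        have := E.vertex_mul_walkStar K w (m ++ [e])
        rw [walkEnd_append] at this
        exact this.symm
      · rw [walkProd, ← ghost_mul_source, mul_assoc (E.ghost K e),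
          E.vertex_mul_vertex_of_ne K hev, mul_zero]
        exact .inr (zero_mul _)
    | cons f l =>
      rw [walkProd_cons, ← mul_assoc]
      by_cases hef : e = f
      · subst hef
        rw [ghost_mul_edge_self, vertex_mul_walkProd E K hl.2]
        exact .inl ⟨⟨E.r e, l, hl.2⟩, ⟨w, m, hm⟩, h, rfl⟩
      · rw [ghost_mul_edge_of_ne E K hef, zero_mul]
        exact .inr (zero_mul _)

theorem gen_mem_gset (a : Gen V D) : Leavitt.mk E K (E.gen K a) ∈ E.GSet K := by
  cases a with
  | vertex v => exact (GSet.ofVertex E K v).2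
  | edge e => exact ⟨⟨E.s e, [e], rfl, trivial⟩, .nil E (E.r e), rfl, (E.edge_mul_range K e).symm⟩
  | ghost e =>
    exact ⟨.nil E (E.r e), ⟨E.s e, [e], rfl, trivial⟩, rfl, (E.range_mul_ghost K e).symm⟩

theorem word_mem_gset_or_eq_zero (x : FreeSemigroup (Gen V D)) :
    Leavitt.mk E K (.single x 1) ∈ E.GSet K ∨ Leavitt.mk E K (.single x 1) = 0 := by
  induction x using FreeSemigroup.recOnMul with
  | ih1 a => exact .inl (E.gen_mem_gset K a)
  | ih2 a y _ hy =>
    have hmul : Leavitt.mk E K (.single (.of a * y) 1) =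
        Leavitt.mk E K (E.gen K a) * Leavitt.mk E K (.single y 1) := by
      rw [← Leavitt.mk_mul, gen, MonoidAlgebra.single_mul_single, mul_one]
    rw [hmul]
    rcases hy with hy | hy
    · exact E.gen_mul_mem_gset_or_eq_zero K a hy
    · exact .inr (by rw [hy, mul_zero])

theorem span_gset : Submodule.span K (E.GSet K) = ⊤ := by
  refine eq_top_iff.2 fun x _ => ?_
  obtain ⟨x, rfl⟩ := Leavitt.mk_surjective E K x
  induction x using MonoidAlgebra.induction_linear with
  | zero => exact zero_mem _
  | add x y hx hy => exact add_mem (hx trivial) (hy trivial)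
  | single x c =>
    have hc : (MonoidAlgebra.single x c : E.FreeAlg K) = c • .single x 1 := by simp
    rw [hc, Leavitt.mk_smul]
    refine Submodule.smul_mem _ c ?_
    rcases E.word_mem_gset_or_eq_zero K x with h | h
    · exact Submodule.subset_span h
    · rw [h]
      exact zero_mem _

end Span

/-! ### Restriction to vertices and unique extension from `G_E` -/

section Restriction

variable {V : Type u} {D : Type w} {E : DirectedGraph V D} {K : Type*} [Field K]
variable {T : Type*} [AddCommGroup T] [Module K T]

theorem isGraphTrace_of_isTrace (τ : E.Leavitt K →ₗ[K] T) (hτ : IsTrace τ) :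
    E.IsGraphTrace fun v => τ (E.vertex K v) := fun v h => by
  change τ (E.vertex K v) = _
  rw [E.vertex_eq_sum K v h, map_sum]
  exact Finset.sum_congr rfl fun e _ => by rw [hτ.2, ghost_mul_edge_self]

theorem IsCanonicalOnG.existsUnique_trace {t : E.GSet K → T} (ht : E.IsCanonicalOnG K t)
    (hd : E.IsGraphTrace fun v => t (GSet.ofVertex E K v)) :
    ∃! τ : E.Leavitt K →ₗ[K] T, IsTrace τ ∧ ∀ x : E.GSet K, τ x = t x := by
  refine ⟨canonicalTrace K hd, ⟨isTrace_canonicalTrace K hd, ?_⟩, fun τ hτ => ?_⟩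
  · rintro ⟨_, p, q, h, rfl⟩
    exact (canonicalTrace_elt_mul_star K hd p q h).trans (ht p q h).symm
  · refine LinearMap.ext_on (E.span_gset K) fun x hx => (hτ.2 ⟨x, hx⟩).trans ?_
    obtain ⟨p, q, h, rfl⟩ := hx
    exact (ht p q h).trans (canonicalTrace_elt_mul_star K hd p q h).symm

end Restriction

end DirectedGraph

theorem mainTheorem8 {V : Type*} {D : Type*} (E : DirectedGraph V D) (K : Type*) [Field K]
    (S : Type*) [NonUnitalRing S]
    (T : Type*) [NonUnitalRing T] [Module K T] [IsScalarTower K T T] [SMulCommClass K T T] :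
    (∀ t : E.GSet K → T, E.IsCanonicalOnG K t →
      (E.IsGraphTrace (fun v => t (DirectedGraph.GSet.ofVertex E K v)) →
        ∃! τ : E.Leavitt K →ₗ[K] T, IsTrace τ ∧ ∀ x : E.GSet K, τ x = t x) ∧
      ((∃ τ : E.Leavitt K →ₗ[K] T, IsTrace τ ∧ ∀ x : E.GSet K, τ x = t x) →
        E.IsGraphTrace (fun v => t (DirectedGraph.GSet.ofVertex E K v)))) ∧
    (∀ t : E.Leavitt K → S, IsTrace t → (E.IsCanonical K t ↔ E.VanishesOffDegreeZero K t)) ∧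
    (∀ t : E.Leavitt K → T, IsTrace t →
      (E.IsCanonical K t → E.IsGaugeInvariant K t) ∧
      (E.VanishesOffDegreeZero K t → E.IsGaugeInvariant K t) ∧
      (CharZero K →
        (E.IsCanonical K t ↔ E.IsGaugeInvariant K t) ∧
        (E.VanishesOffDegreeZero K t ↔ E.IsGaugeInvariant K t))) := by
  refine ⟨fun t ht => ⟨ht.existsUnique_trace, ?_⟩,
    fun t ht => ⟨fun h => h.vanishesOffDegreeZero, fun h => h.isCanonical ht⟩,
    fun t ht => ⟨fun h => h.vanishesOffDegreeZero.isGaugeInvariant, fun h => h.isGaugeInvariant,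
      fun _ => ⟨⟨fun h => h.vanishesOffDegreeZero.isGaugeInvariant,
        fun h => h.vanishesOffDegreeZero.isCanonical ht⟩,
        ⟨fun h => h.isGaugeInvariant, fun h => h.vanishesOffDegreeZero⟩⟩⟩⟩
  rintro ⟨τ, hτ, hτt⟩
  have h := DirectedGraph.isGraphTrace_of_isTrace τ hτ
  rwa [show (fun v => τ (E.vertex K v)) = fun v => t (DirectedGraph.GSet.ofVertex E K v) from
    funext fun v => hτt (DirectedGraph.GSet.ofVertex E K v)] at h
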